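/- **Proposition (Cohen–Macaulay in the sense of ideals implies Cohen–Macaulay).** Let $R$ be a commutative ring with identity (not necessarily Noetherian) and let $M$ be a finitely generated $R$-module. Suppose that $\operatorname{ht}_M(I)=\operatorname{p.grade}_R(I,M)$ for all ideals $I$ of $R$, or that this equality holds for all finitely generated ideals $I$ of $R$. Then $M$ is Cohen–Macaulay in the following sense: every strong parameter sequence on $M$ is an $M$-regular sequence. The notions are as follows. * A finite sequence $x_1,\dots,x_\ell$ in $R$ is *weak $M$-regular* if each $x_i$ is a non-zero-divisor on $M/(x_1,\dots,x_{i-1})M$; it is *$M$-regular* if moreover $M\neq(x_1,\dots,x_\ell)M$. The empty sequence is regarded as regular on every module. The classical grade $\operatorname{grade}(I,M)\in\mathbb N\cup\{\infty\}$ is the supremum of the lengths of the weak $M$-regular sequences contained in $I$, and $$\operatorname{p.grade}_R(I,M)=\lim_{m\to\infty}\operatorname{grade}\bigl(IR[t_1,\dots,t_m],\,R[t_1,\dots,t_m]\otimes_RM\bigr).$$ * For a prime $\mathfrak p$, $\operatorname{ht}_M\mathfrak p$ is the Krull dimension of the $R_{\mathfrak p}$-module $M_{\mathfrak p}$ (the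 Krull dimension of its support), and for an ideal $I$, $\operatorname{ht}_M(I)=\inf\{\operatorname{ht}_M\mathfrak p : \mathfrak p\in\operatorname{Supp}M,\ I\subseteq\mathfrak p\}$, with $\inf\emptyset=\infty$. * Let $\mathbf x=x_1,\dots,x_\ell$ be a finite sequence in $R$, and let $\mathbf x^n=x_1^n,\dots,x_\ell^n$. Let $H_i(\mathbf x,M)$ denote the Koszul homology and $H^i_{\mathbf x}(M)$ the cohomology of the Čech complex $\bigotimes_{j}(0\to R\to R_{x_j}\to0)\otimes_RM$. The sequence $\mathbf x$ is *$M$-weakly proregular* if for each $n$ there is $m\ge n$ such that the map $H_i(\mathbf x^m,M)\to H_i(\mathbf x^n,M)$ is zero for all $i\ge1$; here the map is induced by the tensor product of the chain maps from $0\to M\xrightarrow{x_j^m}M\to0$ to $0\to M\xrightarrow{x_j^n}M\to0$ that are $x_j^{m-n}$ in degree $1$ and the identity in degree $0$. * $\mathbf x$ is a *parameter sequence on $M$* if $\mathbf x$ is $M$-weakly proregular, $\mathbf xM\neq M$, and $H^{\ell}_{\mathbf x}(M)_{\mathfrak p}\neq0$ for all primes $\mathfrak p\in\operatorname{Supp}_R(M/\mathbf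 xM)$. The empty sequence is regarded as a parameter sequence on every module. $\mathbf x$ is a *strong parameter sequence on $M$* if $x_1,\dots,x_i$ is a parameter sequence on $M$ for $i=1,\dots,\ell$. -/

import Mathlib

open scoped TensorProduct

noncomputable section

namespace NonNoethCM

universe u v

/-! ### Signs -/

/-- `(-1)` to the number of elements of `T` that are smaller than `j`. -/
def sgn (R : Type u) [CommRing R] {n : ℕ} (j : Fin n) (T : Finset (Fin n)) : R :=
  (-1) ^ (T.filter (fun i => i < j)).card

lemma sgn_swap_aux (R : Type u) [CommRing R] {n : ℕ} {j k : Fin n} {T : Finset (Fin n)} (hj : j ∉ T) (h : j < k) :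
    sgn R j T * sgn R k (insert j T) + sgn R k T * sgn R j (insert k T) = 0 := by
  have h1 : (insert j T).filter (fun i => i < k) = insert j (T.filter (fun i => i < k)) := by
    rw [Finset.filter_insert, if_pos h]
  have h2 : (insert k T).filter (fun i => i < j) = T.filter (fun i => i < j) := by
    rw [Finset.filter_insert, if_neg (not_lt.mpr h.le)]
  have h3 : j ∉ T.filter (fun i => i < k) := fun h' => hj (Finset.mem_filter.mp h').1
  unfold sgn
  rw [h1, h2, Finset.card_insert_of_notMem h3]
  ring

lemma sgn_swap (R : Type u) [CommRing R] {n : ℕ} {j k : Fin n} {T : Finset (Fin n)} (hj : j ∉ T) (hk : k ∉ T)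
    (h : j ≠ k) : sgn R j T * sgn R k (insert j T) + sgn R k T * sgn R j (insert k T) = 0 := by
  rcases lt_or_gt_of_ne h with h | h
  · exact sgn_swap_aux R hj h
  · rw [add_comm]; exact sgn_swap_aux R hk h

lemma sum_sum_eq_zero {n : ℕ} {A : Type*} [AddCommGroup A] (a : Fin n → Fin n → A)
    (h0 : ∀ j, a j j = 0) (h : ∀ j k, j ≠ k → a j k + a k j = 0) : ∑ j, ∑ k, a j k = 0 := by
  rw [← Fintype.sum_prod_type' (f := a)]
  refine Finset.sum_involution (fun p _ => p.swap) ?_ ?_ (fun _ _ => Finset.mem_univ _)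
    (fun _ _ => Prod.swap_swap _)
  · rintro ⟨j, k⟩ -
    by_cases hjk : j = k
    · subst hjk; simp [h0]
    · exact h j k hjk
  · rintro ⟨j, k⟩ - hne heq
    have : k = j := congrArg Prod.fst heq
    subst this
    exact hne (h0 _)

/-! ### The Koszul complex -/

section Koszul

variable {R : Type u} [CommRing R] {n : ℕ} (x : Fin n → R) (M : Type v) [AddCommGroup M]
  [Module R M]

/-- The subsets of `{0, …, n-1}` with `p` elements. -/
abbrev IdxSet (n p : ℕ) : Type := {S : Finset (Fin n) // S.card = p}

/-- The differential `K_{p+1}(x, M) → K_p(x, M)` of the Koszul complex. Here `K_p(x, M)` is the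
direct sum of copies of `M` indexed by the `p`-element subsets `S` of `{0, …, n-1}`, the copy of
index `S = {s₁ < ⋯ < s_p}` being `e_{s₁} ∧ ⋯ ∧ e_{s_p} ⊗ M`. -/
def koszulD (p : ℕ) : (IdxSet n (p + 1) → M) →ₗ[R] (IdxSet n p → M) where
  toFun f T := ∑ j : Fin n,
    if h : j ∉ T.1 then
      sgn R j T.1 • x j • f ⟨insert j T.1, by rw [Finset.card_insert_of_notMem h, T.2]⟩
    else 0
  map_add' f g := by
    funext T
    simp only [Pi.add_apply, ← Finset.sum_add_distrib]
    refine Finset.sum_congr rfl fun j _ => ?_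
    split_ifs <;> simp
  map_smul' r f := by
    funext T
    simp only [Pi.smul_apply, Finset.smul_sum, RingHom.id_apply]
    refine Finset.sum_congr rfl fun j _ => ?_
    split_ifs
    · rw [smul_zero]
    · rw [smul_comm r (sgn R j T.1), smul_comm r (x j)]

lemma koszulD_comp (p : ℕ) : koszulD x M p ∘ₗ koszulD x M (p + 1) = 0 := by
  refine LinearMap.ext fun f => funext fun T => ?_
  have key : (koszulD x M p ∘ₗ koszulD x M (p + 1)) f T = ∑ j : Fin n, ∑ k : Fin n,
      if h : j ∉ T.1 ∧ k ∉ insert j T.1 then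
        (sgn R j T.1 * sgn R k (insert j T.1)) • (x j * x k) •
          f ⟨insert k (insert j T.1), by
            rw [Finset.card_insert_of_notMem h.2, Finset.card_insert_of_notMem h.1, T.2]⟩
      else 0 := by
    rw [LinearMap.comp_apply]
    simp only [koszulD, LinearMap.coe_mk, AddHom.coe_mk]
    refine Finset.sum_congr rfl fun j _ => ?_
    by_cases hj : j ∉ T.1
    · rw [dif_pos hj, Finset.smul_sum, Finset.smul_sum]
      refine Finset.sum_congr rfl fun k _ => ?_
      by_cases hk : k ∉ insert j T.1
      · rw [dif_pos hk, dif_pos ⟨hj, hk⟩, smul_comm (x j) (sgn R k _), mul_smul, mul_smul]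
      · rw [dif_neg hk, dif_neg (fun h => hk h.2), smul_zero, smul_zero]
    · rw [dif_neg hj]
      symm
      exact Finset.sum_eq_zero fun k _ => dif_neg (fun h => hj h.1)
  rw [key]
  refine sum_sum_eq_zero _ (fun j => dif_neg (by simp)) (fun j k hjk => ?_)
  by_cases h : j ∉ T.1 ∧ k ∉ insert j T.1
  · obtain ⟨hj, hk⟩ := h
    have hk' : k ∉ T.1 := fun h => hk (Finset.mem_insert_of_mem h)
    have hj' : j ∉ insert k T.1 := by simp [hjk, hj]
    rw [dif_pos ⟨hj, hk⟩, dif_pos ⟨hk', hj'⟩]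
    have e : f ⟨insert j (insert k T.1), by
        rw [Finset.card_insert_of_notMem hj', Finset.card_insert_of_notMem hk', T.2]⟩ =
        f ⟨insert k (insert j T.1), by
        rw [Finset.card_insert_of_notMem hk, Finset.card_insert_of_notMem hj, T.2]⟩ := by
      congr 2; exact Finset.insert_comm _ _ _
    rw [e, mul_comm (x k), ← add_smul, sgn_swap R hj hk' hjk, zero_smul]
  · have h' : ¬ (k ∉ T.1 ∧ j ∉ insert k T.1) := by
      simp only [Finset.mem_insert, not_or] at h ⊢
      tauto
    rw [dif_neg h, dif_neg h', add_zero]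

/-- The Koszul complex `K_•(x, M)` of a finite sequence `x` with coefficients in `M`. -/
def koszulComplex : ChainComplex (ModuleCat.{v} R) ℕ :=
  ChainComplex.of (fun p => ModuleCat.of R (IdxSet n p → M))
    (fun p => ModuleCat.ofHom (koszulD x M p))
    (fun p => by
      rw [← ModuleCat.ofHom_comp, koszulD_comp]; rfl)

lemma koszulComplex_d (p : ℕ) :
    (koszulComplex x M).d (p + 1) p = ModuleCat.ofHom (koszulD x M p) := by
  dsimp only [koszulComplex]
  rw [ChainComplex.of_d]

/-- The degree `p` part of the map `K_•(x^m, M) → K_•(x^k, M)`, for `k ≤ m`: on the copy of `M`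
of index `S` it is the multiplication by `∏_{j ∈ S} x_j^(m-k)`. -/
def koszulPowMapX (m k p : ℕ) : (IdxSet n p → M) →ₗ[R] (IdxSet n p → M) where
  toFun f S := (∏ j ∈ S.1, x j ^ (m - k)) • f S
  map_add' f g := by funext S; simp
  map_smul' r f := by funext S; simp [smul_comm r]

lemma koszulPowMapX_comm {m k : ℕ} (h : k ≤ m) (p : ℕ) :
    koszulD (fun j => x j ^ k) M p ∘ₗ koszulPowMapX x M m k (p + 1) =
      koszulPowMapX x M m k p ∘ₗ koszulD (fun j => x j ^ m) M p := by
  refine LinearMap.ext fun f => funext fun T => ?_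
  simp only [LinearMap.comp_apply, koszulD, koszulPowMapX, LinearMap.coe_mk, AddHom.coe_mk,
    Finset.smul_sum]
  refine Finset.sum_congr rfl fun j _ => ?_
  by_cases hj : j ∉ T.1
  · rw [dif_pos hj, dif_pos hj, smul_comm _ (sgn R j T.1)]
    congr 1
    rw [← mul_smul, ← mul_smul, Finset.prod_insert hj, ← mul_assoc, ← pow_add,
      Nat.add_sub_cancel' h, mul_comm]
  · rw [dif_neg hj, dif_neg hj, smul_zero]

/-- The chain map `φ^m_k(x, M) : K_•(x^m, M) → K_•(x^k, M)` for `k ≤ m`, that is the tensor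
product of the maps `(x_j^(m-k), id)` from `M → M` (multiplication by `x_j^m`) to `M → M`
(multiplication by `x_j^k`). -/
def koszulPowMap {m k : ℕ} (h : k ≤ m) :
    koszulComplex (fun j => x j ^ m) M ⟶ koszulComplex (fun j => x j ^ k) M :=
  ChainComplex.ofHom (fun p => ModuleCat.ofHom (koszulPowMapX x M m k p))
    (fun p => by
      dsimp only [koszulComplex]
      rw [ChainComplex.of_d, ChainComplex.of_d, ← ModuleCat.ofHom_comp, ← ModuleCat.ofHom_comp, koszulPowMapX_comm x M h])

/-- The sequence `x` is `M`-weakly proregular: for each `k` there is `m ≥ k` such that the map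
`H_i(x^m, M) → H_i(x^k, M)` is zero for all `i ≥ 1`. -/
def IsWeaklyProregular : Prop :=
  ∀ k : ℕ, ∃ (m : ℕ) (h : k ≤ m), ∀ i : ℕ, 1 ≤ i →
    HomologicalComplex.homologyMap (koszulPowMap x M h) i = 0

end Koszul

/-! ### The Čech complex -/

section Cech

variable {R : Type u} [CommRing R] (M : Type v) [AddCommGroup M] [Module R M]

/-- The localization `M_a` of `M` at the powers of `a`. -/
abbrev Away (a : R) : Type (max u v) := LocalizedModule (Submonoid.powers a) M

lemma isUnit_of_dvd {a b : R} (h : a ∣ b) (s : Submonoid.powers a) :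
    IsUnit (algebraMap R (Module.End R (Away M b)) (s : R)) := by
  obtain ⟨c, rfl⟩ := h
  obtain ⟨_, k, rfl⟩ := s
  have hu : IsUnit (algebraMap R (Module.End R (Away M (a * c))) (a * c)) :=
    IsLocalizedModule.map_units (LocalizedModule.mkLinearMap (Submonoid.powers (a * c)) M)
      ⟨a * c, Submonoid.mem_powers _⟩
  rw [map_mul] at hu
  have ha : IsUnit (algebraMap R (Module.End R (Away M (a * c))) a) :=
    ((Algebra.commute_algebraMap_left _ _).isUnit_mul_iff.mp hu).1
  simpa using ha.pow k

/-- The natural map `M_a → M_b` for `a ∣ b`. -/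
def awayMap {a b : R} (h : a ∣ b) : Away M a →ₗ[R] Away M b :=
  IsLocalizedModule.lift (Submonoid.powers a) (LocalizedModule.mkLinearMap (Submonoid.powers a) M)
    (LocalizedModule.mkLinearMap (Submonoid.powers b) M) (isUnit_of_dvd M h)

lemma awayMap_mk {a b : R} (h : a ∣ b) (m : M) :
    awayMap M h (LocalizedModule.mkLinearMap (Submonoid.powers a) M m) =
      LocalizedModule.mkLinearMap (Submonoid.powers b) M m :=
  IsLocalizedModule.lift_apply _ _ _ _ _

lemma awayMap_comp {a b c : R} (h : a ∣ b) (h' : b ∣ c) :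
    awayMap M h' ∘ₗ awayMap M h = awayMap M (h.trans h') := by
  refine IsLocalizedModule.ext (Submonoid.powers a)
    (LocalizedModule.mkLinearMap (Submonoid.powers a) M) (isUnit_of_dvd M (h.trans h')) ?_
  refine LinearMap.ext fun m => ?_
  simp only [LinearMap.comp_apply, awayMap_mk]

variable {n : ℕ} (x : Fin n → R)

/-- The module `C^p(x; M)` of the Čech complex: the direct sum of the localizations
`M_{x_{s₁} ⋯ x_{s_p}}` over the `p`-element subsets `{s₁ < ⋯ < s_p}` of `{0, …, n-1}`. -/
abbrev CechX (p : ℕ) : Type (max u v) := (S : IdxSet n p) → Away M (∏ j ∈ S.1, x j)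

lemma prod_erase_dvd (T : Finset (Fin n)) (j : Fin n) : ∏ i ∈ T.erase j, x i ∣ ∏ i ∈ T, x i :=
  Finset.prod_dvd_prod_of_subset _ _ _ (Finset.erase_subset _ _)

/-- The differential `C^p(x; M) → C^{p+1}(x; M)` of the Čech complex: its component at `T` is the
alternating sum, over `j ∈ T`, of the localization maps from the component at `T \ {j}`. -/
def cechD (p : ℕ) : CechX M x p →ₗ[R] CechX M x (p + 1) where
  toFun f T := ∑ j : Fin n,
    if h : j ∈ T.1 then
      sgn R j (T.1.erase j) • awayMap M (prod_erase_dvd x T.1 j)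
        (f ⟨T.1.erase j, by rw [Finset.card_erase_of_mem h, T.2, Nat.add_sub_cancel]⟩)
    else 0
  map_add' f g := by
    funext T
    simp only [Pi.add_apply, ← Finset.sum_add_distrib]
    refine Finset.sum_congr rfl fun j _ => ?_
    split_ifs <;> simp
  map_smul' r f := by
    funext T
    simp only [Pi.smul_apply, Finset.smul_sum, RingHom.id_apply]
    refine Finset.sum_congr rfl fun j _ => ?_
    split_ifs
    · rw [map_smul, smul_comm r (sgn R j _)]
    · rw [smul_zero]

lemma awayMap_congr {p : ℕ} (f : CechX M x p) {b : R} {S S' : IdxSet n p} (e : S = S')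
    (h : ∏ j ∈ S.1, x j ∣ b) (h' : ∏ j ∈ S'.1, x j ∣ b) :
    awayMap M h (f S) = awayMap M h' (f S') := by
  subst e; rfl

lemma cechD_comp (p : ℕ) : cechD M x (p + 1) ∘ₗ cechD M x p = 0 := by
  refine LinearMap.ext fun f => funext fun T => ?_
  have key : (cechD M x (p + 1) ∘ₗ cechD M x p) f T = ∑ j : Fin n, ∑ k : Fin n,
      if h : j ∈ T.1 ∧ k ∈ T.1.erase j then
        (sgn R j (T.1.erase j) * sgn R k ((T.1.erase j).erase k)) •
          awayMap M ((prod_erase_dvd x (T.1.erase j) k).trans (prod_erase_dvd x T.1 j))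
          (f ⟨(T.1.erase j).erase k, by
            rw [Finset.card_erase_of_mem h.2, Finset.card_erase_of_mem h.1, T.2]; omega⟩)
      else 0 := by
    rw [LinearMap.comp_apply]
    simp only [cechD, LinearMap.coe_mk, AddHom.coe_mk]
    refine Finset.sum_congr rfl fun j _ => ?_
    by_cases hj : j ∈ T.1
    · rw [dif_pos hj, map_sum, Finset.smul_sum]
      refine Finset.sum_congr rfl fun k _ => ?_
      by_cases hk : k ∈ T.1.erase j
      · rw [dif_pos hk, dif_pos ⟨hj, hk⟩, map_smul, mul_smul, ← LinearMap.comp_apply,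
          awayMap_comp]
      · rw [dif_neg hk, dif_neg (fun h => hk h.2), map_zero, smul_zero]
    · rw [dif_neg hj]
      symm
      exact Finset.sum_eq_zero fun k _ => dif_neg (fun h => hj h.1)
  rw [key]
  refine sum_sum_eq_zero _ (fun j => dif_neg (by simp)) (fun j k hjk => ?_)
  by_cases h : j ∈ T.1 ∧ k ∈ T.1.erase j
  · obtain ⟨hj, hk⟩ := h
    have hk' : k ∈ T.1 := Finset.mem_of_mem_erase hk
    have hj' : j ∈ T.1.erase k := Finset.mem_erase.mpr ⟨hjk, hj⟩
    have hU : (T.1.erase k).erase j = (T.1.erase j).erase k := Finset.erase_right_comm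
    rw [dif_pos ⟨hj, hk⟩, dif_pos ⟨hk', hj'⟩,
      awayMap_congr M x f (Subtype.ext hU :
          (⟨(T.1.erase k).erase j, by
            rw [Finset.card_erase_of_mem hj', Finset.card_erase_of_mem hk', T.2]; omega⟩ :
            IdxSet n p) =
          ⟨(T.1.erase j).erase k, by
            rw [Finset.card_erase_of_mem hk, Finset.card_erase_of_mem hj, T.2]; omega⟩) _
        ((prod_erase_dvd x (T.1.erase j) k).trans (prod_erase_dvd x T.1 j)), ← add_smul, hU]
    have e1 : T.1.erase j = insert k ((T.1.erase j).erase k) := (Finset.insert_erase hk).symm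
    have e2 : T.1.erase k = insert j ((T.1.erase j).erase k) := by
      rw [← hU]; exact (Finset.insert_erase hj').symm
    have hs := sgn_swap R (j := j) (k := k) (T := (T.1.erase j).erase k) (by simp) (by simp) hjk
    rw [← e1, ← e2] at hs
    rw [show sgn R j (T.1.erase j) * sgn R k ((T.1.erase j).erase k) +
      sgn R k (T.1.erase k) * sgn R j ((T.1.erase j).erase k) = 0 by rw [← hs]; ring, zero_smul]
  · have h' : ¬ (k ∈ T.1 ∧ j ∈ T.1.erase k) := by
      simp only [Finset.mem_erase, ne_eq] at h ⊢
      tauto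
    rw [dif_neg h, dif_neg h', add_zero]

/-- The Čech complex `C(x; M)` of a finite sequence `x` with coefficients in `M`. -/
def cechComplex : CochainComplex (ModuleCat.{max u v} R) ℕ :=
  CochainComplex.of (fun p => ModuleCat.of R (CechX M x p))
    (fun p => ModuleCat.ofHom (cechD M x p))
    (fun p => by
      rw [← ModuleCat.ofHom_comp, cechD_comp]; rfl)

lemma cechComplex_d (p : ℕ) :
    (cechComplex M x).d p (p + 1) = ModuleCat.ofHom (cechD M x p) := by
  dsimp only [cechComplex]
  rw [CochainComplex.of_d]

/-- The `i`-th Čech cohomology `H^i_x(M)`. -/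
def cechCohomology (i : ℕ) : ModuleCat.{max u v} R := (cechComplex M x).homology i

end Cech

/-! ### Classical grade, polynomial grade and heights -/

section Grade

/-- The classical grade of `I` on `M`: the supremum of the lengths of the weak `M`-regular
sequences contained in `I`. -/
def grade {R : Type u} [CommRing R] (I : Ideal R) (M : Type v) [AddCommGroup M] [Module R M] :
    ℕ∞ :=
  ⨆ (rs : List R) (_ : (∀ r ∈ rs, r ∈ I) ∧ RingTheory.Sequence.IsWeaklyRegular M rs),
    (rs.length : ℕ∞)

variable {R : Type u} [CommRing R] (I : Ideal R) (M : Type v) [AddCommGroup M] [Module R M]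

/-- The classical grade of `I R[t₁, …, t_m]` on `R[t₁, …, t_m] ⊗ M`. -/
def gradeAdjoin (m : ℕ) : ℕ∞ :=
  grade (I.map (algebraMap R (MvPolynomial (Fin m) R))) (MvPolynomial (Fin m) R ⊗[R] M)

/-- The polynomial grade of `I` on `M`: the limit of the classical grades of `I R[t₁, …, t_m]` on
`R[t₁, …, t_m] ⊗ M` as `m → ∞`. The limit exists, see `tendsto_polynomialGrade`. -/
def polynomialGrade : ℕ∞ :=
  Filter.limUnder Filter.atTop (gradeAdjoin I M)

lemma grade_le_of_flat (A B : Type u) [CommRing A] [CommRing B] [Algebra R A] [Algebra R B]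
    [Algebra A B] [IsScalarTower R A B] [Module.Flat A B] :
    grade (I.map (algebraMap R A)) (A ⊗[R] M) ≤ grade (I.map (algebraMap R B)) (B ⊗[R] M) := by
  refine iSup₂_le fun rs h => ?_
  have h2 := h.2.of_flat_of_isBaseChange (TensorProduct.isBaseChange A (A ⊗[R] M) B)
  rw [LinearEquiv.isWeaklyRegular_congr
    (TensorProduct.AlgebraTensorModule.cancelBaseChange R A B B M)] at h2
  refine le_trans ?_ (le_iSup₂ (rs.map (algebraMap A B)) ⟨?_, h2⟩)
  · simp
  · intro r hr
    obtain ⟨s, hs, rfl⟩ := List.mem_map.mp hr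
    rw [IsScalarTower.algebraMap_eq R A B, ← Ideal.map_map]
    exact Ideal.mem_map_of_mem _ (h.1 s hs)

lemma gradeAdjoin_le_succ (m : ℕ) : gradeAdjoin I M m ≤ gradeAdjoin I M (m + 1) := by
  let _ : Algebra (MvPolynomial (Fin m) R) (MvPolynomial (Fin (m + 1)) R) :=
    ((MvPolynomial.finSuccEquiv R m).symm.toRingEquiv.toRingHom.comp Polynomial.C).toAlgebra
  have _ : IsScalarTower R (MvPolynomial (Fin m) R) (MvPolynomial (Fin (m + 1)) R) :=
    IsScalarTower.of_algebraMap_eq' (MvPolynomial.finSuccEquiv_comp_C_eq_C m).symm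
  have _ : Module.Flat (MvPolynomial (Fin m) R) (MvPolynomial (Fin (m + 1)) R) := by
    refine Module.Flat.of_linearEquiv (M := Polynomial (MvPolynomial (Fin m) R))
      { (MvPolynomial.finSuccEquiv R m).toRingEquiv with
        map_smul' := fun a b => ?_ }
    change MvPolynomial.finSuccEquiv R m
      ((MvPolynomial.finSuccEquiv R m).symm (Polynomial.C a) * b) = a • _
    rw [map_mul, AlgEquiv.apply_symm_apply, Polynomial.smul_eq_C_mul]
    rfl
  exact grade_le_of_flat I M (MvPolynomial (Fin m) R) (MvPolynomial (Fin (m + 1)) R)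

lemma tendsto_gradeAdjoin :
    Filter.Tendsto (gradeAdjoin I M) Filter.atTop (nhds (⨆ m, gradeAdjoin I M m)) :=
  tendsto_atTop_iSup (monotone_nat_of_le_succ (gradeAdjoin_le_succ I M))

lemma polynomialGrade_eq_iSup : polynomialGrade I M = ⨆ m, gradeAdjoin I M m :=
  (tendsto_gradeAdjoin I M).limUnder_eq

lemma tendsto_polynomialGrade :
    Filter.Tendsto (gradeAdjoin I M) Filter.atTop (nhds (polynomialGrade I M)) := by
  rw [polynomialGrade_eq_iSup]
  exact tendsto_gradeAdjoin I M

/-- The height `ht_M p` of a prime ideal: the Krull dimension of the `R_p`-module `M_p` (it is `⊥`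
if `M_p = 0`). -/
def primeHeight (p : PrimeSpectrum R) : WithBot ℕ∞ :=
  Module.supportDim (Localization.AtPrime p.asIdeal) (LocalizedModule p.asIdeal.primeCompl M)

/-- The height `ht_M I`: the infimum of `ht_M p` over the primes `p ∈ Supp M ∩ V(I)` (it is `⊤` if
there is no such prime). -/
def idealHeight : WithBot ℕ∞ :=
  ⨅ p ∈ Module.support R M ∩ PrimeSpectrum.zeroLocus (I : Set R), primeHeight M p

end Grade

/-! ### Parameter sequences and Cohen-Macaulay modules -/

section CM

variable (R : Type u) [CommRing R] (M : Type v) [AddCommGroup M] [Module R M]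

/-- `M`-regular sequences; the empty sequence is regular on every module, also on the zero
module. -/
def IsRegularSeq (xs : List R) : Prop :=
  xs = [] ∨ RingTheory.Sequence.IsRegular M xs

/-- Parameter sequences on `M`; the empty sequence is one on every module. -/
def IsParameterSeq (xs : List R) : Prop :=
  xs = [] ∨
    (IsWeaklyProregular xs.get M ∧
      (Ideal.ofList xs • ⊤ : Submodule R M) ≠ ⊤ ∧
      ∀ p ∈ Module.support R (M ⧸ (Ideal.ofList xs • ⊤ : Submodule R M)),
        Nontrivial (LocalizedModule p.asIdeal.primeCompl (cechCohomology M xs.get xs.length)))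

/-- Strong parameter sequences on `M`: `x₁, …, x_i` is a parameter sequence on `M` for all
`i = 1, …, ℓ`. -/
def IsStrongParameterSeq (xs : List R) : Prop :=
  ∀ i : ℕ, 1 ≤ i → i ≤ xs.length → IsParameterSeq R M (xs.take i)

/-- `M` is Cohen-Macaulay if every strong parameter sequence on `M` is an `M`-regular sequence. -/
def IsCohenMacaulay : Prop :=
  ∀ xs : List R, IsStrongParameterSeq R M xs → IsRegularSeq R M xs

/-- `M` is Cohen-Macaulay in the sense of ideals. -/
def IsCohenMacaulayIdeals : Prop :=
  ∀ I : Ideal R, idealHeight I M = (polynomialGrade I M : WithBot ℕ∞)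

/-- `M` is Cohen-Macaulay in the sense of finitely generated ideals. -/
def IsCohenMacaulayFGIdeals : Prop :=
  ∀ I : Ideal R, I.FG → idealHeight I M = (polynomialGrade I M : WithBot ℕ∞)

end CM

end NonNoethCM

end

/-! Let `x₁, …, x_ℓ` be a nonempty strong parameter sequence. Since `xM ≠ M` is part of the
definition, only weak regularity needs proof, and it is obtained one element at a time by comparing
height and grade of `J = (x₁, …, x_{i+1})`.

Height: a prime of `Supp M` containing `J` lies in `Supp (M/JM)`, so the top Čech cohomology is
nonzero there. A Grothendieck vanishing argument (`le_primeHeight_of_nontrivial_cechCohomology`)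
then gives `dim M_p ≥ i + 1`, so `ht_M J ≥ i + 1`. Without Noetherian hypotheses the vanishing rests
on the elementary description of Krull dimension by iterated boundaries: if `dim M_p < n`, then
locally at `p` and modulo `Ann M`, some monomial `∏ x_j^k` lies in the ideal of the powers
`x_j^(k+1)`. This turns every top-degree Čech cochain into a boundary locally at `p`.

Grade: by hypothesis the polynomial grade of `J` is also at least `i + 1`, so over some polynomial
ring `J` contains a weakly regular sequence longer than `x₁, …, x_i`. Rees' Ext argument
(`isSMulRegular_quotient_of_length_lt`) makes `x_{i+1}` regular on `M/(x₁, …, x_i)M` after this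
extension, and faithful flatness brings the regularity back down. -/

namespace NonNoethCM

/-! ### Grade, Ext vanishing and regularity of one further element -/

section Rees

universe w w'

open CategoryTheory CategoryTheory.Abelian RingTheory.Sequence

variable {A : Type w} [CommRing A]

/-- If the ideal `I` annihilates `Q` and contains a weakly `N`-regular sequence `rs`, then
`Ext^i(Q, N) = 0` for all `i` smaller than the length of `rs`. -/
lemma subsingleton_ext_of_isWeaklyRegular [Small.{w'} A] {I : Ideal A} (Q : ModuleCat.{w'} A)
    (hQ : I ≤ Module.annihilator A Q) (rs : List A) (N : ModuleCat.{w'} A)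
    (mem : ∀ r ∈ rs, r ∈ I) (reg : IsWeaklyRegular N rs) (i : ℕ) (hi : i < rs.length) :
    Subsingleton (Ext Q N i) := by
  induction rs generalizing N i with
  | nil => simp at hi
  | cons a rs ih =>
    rw [isWeaklyRegular_cons_iff] at reg
    simp only [List.mem_cons, forall_eq_or_imp] at mem
    -- Multiplication by `a` on `Ext^i(Q, N)` is zero because `a` kills `Q`; it is also injective,
    -- so the group vanishes.
    let g := AddCommGrpCat.ofHom ((Ext.mk₀ (N.smulShortComplex a).f).postcomp Q (add_zero i))
    have mono_g : Mono g := by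
      cases i with
      | zero =>
        have := reg.1.smulShortComplex_shortExact.mono_f
        exact Ext.mono_postcomp_mk₀_of_mono Q _
      | succ i =>
        refine (Ext.covariant_sequence_exact₁' Q reg.1.smulShortComplex_shortExact i (i + 1)
          rfl).mono_g ((AddCommGrpCat.isZero_of_iff_subsingleton.mpr ?_).eq_zero_of_src _)
        -- The kernel of `g` in degree `i + 1` is the image of `Ext^i(Q, N/aN)`.
        exact ih (ModuleCat.of A (QuotSMulTop a N)) mem.2 reg.2 i (by simpa using hi)
    have zero_g : g = 0 := Ext.postcomp_smul_id_eq_zero_of_mem_annihilator (hQ mem.1) i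
    exact AddCommGrpCat.subsingleton_of_isZero (Limits.IsZero.of_mono_eq_zero _ zero_g)

/-- If `xs` is weakly `N`-regular and `Ext^i(Q, N) = 0` for `i ≤ xs.length`, then every linear map
`Q → N / xs N` is zero. -/
lemma subsingleton_linearMap_of_isWeaklyRegular [Small.{w'} A] (Q : ModuleCat.{w'} A)
    (xs : List A) (N : ModuleCat.{w'} A) (reg : IsWeaklyRegular N xs)
    (ext : ∀ i ≤ xs.length, Subsingleton (Ext Q N i)) :
    Subsingleton (Q →ₗ[A] (N ⧸ (Ideal.ofList xs • ⊤ : Submodule A N))) := by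
  induction xs generalizing N with
  | nil =>
    have h0 := ext 0 le_rfl
    have h1 : Subsingleton (Q →ₗ[A] N) :=
      (Ext.addEquiv₀.trans ModuleCat.homAddEquiv).symm.subsingleton
    have e : (N ⧸ (Ideal.ofList ([] : List A) • ⊤ : Submodule A N)) ≃ₗ[A] N :=
      Submodule.quotEquivOfEqBot _ (by simp)
    exact (LinearEquiv.congrRight (M := Q) e).toEquiv.subsingleton
  | cons a xs ih =>
    rw [isWeaklyRegular_cons_iff] at reg
    -- `Ext^i(Q, N/aN)` sits between `Ext^i(Q, N)` and `Ext^(i+1)(Q, N)`, so dividing by `a` costs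
    -- one degree of vanishing.
    have h := ih (ModuleCat.of A (QuotSMulTop a N)) reg.2 fun i hi => by
      have z1 := AddCommGrpCat.isZero_of_iff_subsingleton.mpr
        (ext i (hi.trans (by simp)))
      have z2 := AddCommGrpCat.isZero_of_iff_subsingleton.mpr
        (ext (i + 1) (by simpa using hi))
      exact AddCommGrpCat.subsingleton_of_isZero <| ShortComplex.Exact.isZero_of_both_zeros
        ((Ext.covariant_sequence_exact₃' Q reg.1.smulShortComplex_shortExact) i (i + 1) rfl)
        (z1.eq_zero_of_src _) (z2.eq_zero_of_tgt _)
    exact (LinearEquiv.congrRight (M := Q)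
      (Submodule.quotOfListConsSMulTopEquivQuotSMulTopInner N a xs)).toEquiv.subsingleton

/-- If the ideal generated by `xs` and `x` contains a weakly `N`-regular sequence which is longer
than the weakly `N`-regular sequence `xs`, then `x` is regular on `N / xs N`. -/
lemma isSMulRegular_quotient_of_length_lt {N : Type w'} [AddCommGroup N] [Module A N]
    [Small.{w'} A] {xs : List A} {x : A} (hxs : IsWeaklyRegular N xs) {ys : List A}
    (hys : IsWeaklyRegular N ys) (mem : ∀ y ∈ ys, y ∈ Ideal.ofList (xs ++ [x]))
    (hlen : xs.length < ys.length) :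
    IsSMulRegular (N ⧸ (Ideal.ofList xs • ⊤ : Submodule A N)) x := by
  set I := Ideal.ofList (xs ++ [x]) with hI
  -- The quotient `A/I`, moved into the universe of `N` so that both are objects of one module
  -- category.
  let Q := ModuleCat.of A (Shrink.{w'} (A ⧸ I))
  have hQ : I ≤ Module.annihilator A Q := by
    rw [show Module.annihilator A Q = Module.annihilator A (A ⧸ I) from
      (Shrink.linearEquiv A (A ⧸ I)).annihilator_eq, Ideal.annihilator_quotient]
  have hsub := subsingleton_linearMap_of_isWeaklyRegular Q xs (ModuleCat.of A N) hxs fun i hi =>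
    subsingleton_ext_of_isWeaklyRegular Q hQ ys (ModuleCat.of A N) mem hys i (hi.trans_lt hlen)
  rw [isSMulRegular_iff_right_eq_zero_of_smul]
  intro z hz
  -- The class `z` is killed by `x` by assumption and by `xs` automatically, so `1 ↦ z` defines a
  -- map `A/I → N/xs N`, which must be zero.
  have hle : I ≤ LinearMap.ker (LinearMap.toSpanSingleton A _ z) := by
    rw [hI, Ideal.ofList_append, Ideal.ofList_singleton, sup_le_iff,
      Ideal.span_singleton_le_iff_mem]
    refine ⟨fun a ha => ?_, hz⟩
    obtain ⟨n, rfl⟩ := Submodule.Quotient.mk_surjective _ z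
    rw [LinearMap.mem_ker, LinearMap.toSpanSingleton_apply, ← Submodule.Quotient.mk_smul,
      Submodule.Quotient.mk_eq_zero]
    exact Submodule.smul_mem_smul ha trivial
  let φ := (Submodule.liftQ I _ hle).comp (Shrink.linearEquiv A (A ⧸ I)).toLinearMap
  have hφ : φ = 0 := hsub.elim _ _
  have h1 := LinearMap.congr_fun hφ
    ((Shrink.linearEquiv A (A ⧸ I)).symm (Submodule.Quotient.mk 1))
  have h2 : φ ((Shrink.linearEquiv A (A ⧸ I)).symm (Submodule.Quotient.mk 1)) = z := by
    simp only [φ, LinearMap.comp_apply, LinearEquiv.coe_coe, LinearEquiv.apply_symm_apply]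
    rw [Submodule.liftQ_apply, LinearMap.toSpanSingleton_apply, one_smul]
  exact h2.symm.trans h1

/-- If the polynomial grade of the ideal generated by `xs` and `x` is larger than the length of the
weakly `M`-regular sequence `xs`, then `x` is regular on `M / xs M`. -/
lemma isSMulRegular_quotient_of_lt_polynomialGrade {M : Type w'} [AddCommGroup M] [Module A M]
    {xs : List A} {x : A} (hxs : IsWeaklyRegular M xs)
    (h : (xs.length : ℕ∞) < polynomialGrade (Ideal.ofList (xs ++ [x])) M) :
    IsSMulRegular (M ⧸ (Ideal.ofList xs • ⊤ : Submodule A M)) x := by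
  -- The limit is a supremum, so the strict inequality is already witnessed by a sequence `ys` over
  -- finitely many variables.
  rw [polynomialGrade_eq_iSup, lt_iSup_iff] at h
  obtain ⟨m, h⟩ := h
  rw [gradeAdjoin, grade, lt_iSup_iff] at h
  obtain ⟨ys, h⟩ := h
  rw [lt_iSup_iff] at h
  obtain ⟨⟨mem, hys⟩, h⟩ := h
  let B := MvPolynomial (Fin m) A
  have hxs' : IsWeaklyRegular (B ⊗[A] M) (xs.map (algebraMap A B)) :=
    hxs.of_flat_of_isBaseChange (TensorProduct.isBaseChange A M B)
  have hreg : IsSMulRegular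
      (B ⊗[A] M ⧸ (Ideal.ofList (xs.map (algebraMap A B)) • ⊤ : Submodule B (B ⊗[A] M)))
      (algebraMap A B x) := by
    refine isSMulRegular_quotient_of_length_lt hxs' hys (fun y hy => ?_)
      (by simpa using h)
    have := mem y hy
    rwa [Ideal.map_ofList, List.map_append] at this
  rw [← Ideal.map_ofList,
    LinearEquiv.isSMulRegular_congr
      (TensorProduct.tensorQuotMapSMulEquivTensorQuot M B (Ideal.ofList xs))] at hreg
  rw [isSMulRegular_iff_right_eq_zero_of_smul] at hreg ⊢
  intro z hz
  cases subsingleton_or_nontrivial A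
  · exact (Module.subsingleton A _).elim _ _
  -- The map `M/xs M → B ⊗ M/xs M` is injective, so an element killed by `x` can be tested after
  -- base change.
  apply Module.FaithfullyFlat.tensorProduct_mk_injective (A := A) (B := B)
  rw [map_zero]
  refine hreg _ ?_
  rw [algebraMap_smul, ← map_smul, hz, map_zero]

end Rees

/-! ### Krull dimension through iterated boundary monoids -/

section Dimension

universe w w'

variable {A : Type w} [CommRing A]

/-- The elements `x^m (s + a x)` with `s ∈ S`. A prime ideal disjoint from this submonoid does not
contain `x`, and its sum with `(x)` is disjoint from `S`. -/
def boundaryMonoid (S : Submonoid A) (x : A) : Submonoid A where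
  carrier := {r | ∃ m : ℕ, ∃ s ∈ S, ∃ a : A, r = x ^ m * (s + a * x)}
  one_mem' := ⟨0, 1, S.one_mem, 0, by ring⟩
  mul_mem' := by
    rintro _ _ ⟨m, s, hs, a, rfl⟩ ⟨m', s', hs', a', rfl⟩
    exact ⟨m + m', s * s', S.mul_mem hs hs', s * a' + a * s' + a * a' * x, by ring⟩

/-- The iteration of `boundaryMonoid` along a list. -/
def iterBoundaryMonoid (S : Submonoid A) (xs : List A) : Submonoid A :=
  xs.foldr (fun x T => boundaryMonoid T x) S

/-- The ideal `q + (x)` misses `S`, hence extends to a prime missing `S`; this prime is strictly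
larger because `x ∉ q`. -/
lemma exists_prime_gt_of_disjoint_boundaryMonoid {S : Submonoid A} {x : A} (q : PrimeSpectrum A)
    (h : Disjoint (q.asIdeal : Set A) (boundaryMonoid S x)) :
    ∃ p : PrimeSpectrum A, q < p ∧ Disjoint (p.asIdeal : Set A) S := by
  have hd : Disjoint ((q.asIdeal ⊔ Ideal.span {x} : Ideal A) : Set A) S := by
    rw [Set.disjoint_left]
    intro s hs hsS
    obtain ⟨y, hy, z, hz, rfl⟩ := Submodule.mem_sup.mp hs
    obtain ⟨a, rfl⟩ := Ideal.mem_span_singleton'.mp hz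
    -- If `s = y + a x` lies in `S` with `y ∈ q`, then `y = x^0 (s - a x)` is in the boundary
    -- monoid.
    exact Set.disjoint_left.mp h hy ⟨0, _, hsS, -a, by ring⟩
  obtain ⟨p, hp, hle, hpS⟩ := Ideal.exists_le_prime_disjoint _ S hd
  refine ⟨⟨p, hp⟩, lt_of_le_of_ne (le_sup_left.trans hle) ?_, hpS⟩
  rintro rfl
  have hx : x ∈ p := hle (Ideal.mem_sup_right (Ideal.mem_span_singleton_self x))
  exact Set.disjoint_left.mp h hx ⟨1, 1, S.one_mem, 0, by ring⟩

/-- Each element of the list peels off one boundary and contributes one strict inclusion. -/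
lemma exists_ltSeries_of_disjoint_iterBoundaryMonoid {S : Submonoid A} (xs : List A)
    (q : PrimeSpectrum A) (h : Disjoint (q.asIdeal : Set A) (iterBoundaryMonoid S xs)) :
    ∃ l : LTSeries (PrimeSpectrum A), l.length = xs.length ∧ l.head = q ∧
      Disjoint (l.last.asIdeal : Set A) S := by
  induction xs generalizing q with
  | nil => exact ⟨RelSeries.singleton _ q, rfl, rfl, h⟩
  | cons x xs ih =>
    obtain ⟨p, hqp, hp⟩ := exists_prime_gt_of_disjoint_boundaryMonoid q h
    obtain ⟨l, hl, rfl, hd⟩ := ih p hp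
    refine ⟨l.cons q hqp, by simp [hl], RelSeries.head_cons _ _ _, ?_⟩
    rwa [RelSeries.last_cons]

/-- Unwinds the nested form of `r`. The claim is made for all large `k` so that the exponent of the
head can be matched with that of the tail. -/
lemma exists_mul_prod_pow_mem_of_mem_iterBoundaryMonoid {S : Submonoid A} (xs : List A) {r : A}
    (h : r ∈ iterBoundaryMonoid S xs) : ∃ s ∈ S, ∃ k₀ : ℕ, ∀ k ≥ k₀,
      s * (xs.map (· ^ k)).prod ∈ Ideal.span {r} ⊔ Ideal.ofList (xs.map (· ^ (k + 1))) := by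
  induction xs generalizing r with
  | nil => exact ⟨r, h, 0, fun k _ => Ideal.mem_sup_left (by simp)⟩
  | cons x xs ih =>
    obtain ⟨m, s', hs', a, rfl⟩ := h
    obtain ⟨s, hs, k₀, ih⟩ := ih hs'
    refine ⟨s, hs, max k₀ m, fun k hk => ?_⟩
    obtain ⟨y, hy, z, hz, e⟩ := Submodule.mem_sup.mp (ih k ((le_max_left _ _).trans hk))
    obtain ⟨c, rfl⟩ := Ideal.mem_span_singleton'.mp hy
    obtain ⟨d, rfl⟩ := Nat.exists_eq_add_of_le ((le_max_right _ _).trans hk)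
    simp only [List.map_cons, List.prod_cons, Ideal.ofList_cons]
    -- With `k = m + d`, multiply `s ∏ y^k = c s' + z` by `x^k` and substitute `x^k s' = x^d r - a
    -- x^(k+1)`.
    have e' : s * (x ^ (m + d) * (xs.map (· ^ (m + d))).prod) =
        c * x ^ d * (x ^ m * (s' + a * x)) +
          (-(c * a) * x ^ (m + d + 1) + x ^ (m + d) * z) := by
      linear_combination (-x ^ (m + d)) * e
    rw [e']
    refine Submodule.add_mem_sup (Ideal.mul_mem_left _ _ (Ideal.mem_span_singleton_self _))
      (Submodule.add_mem_sup (Ideal.mul_mem_left _ _ (Ideal.mem_span_singleton_self _))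
        (Ideal.mul_mem_left _ _ hz))

variable {M : Type w'} [AddCommGroup M] [Module A M]

/-- A prime in the support of `M` contained in `p` gives a prime in the support of `M_p`. -/
lemma mem_support_localizedModule {p : Ideal A} [p.IsPrime]
    (q : PrimeSpectrum (Localization.AtPrime p))
    (hq : q.comap (algebraMap A (Localization.AtPrime p)) ∈ Module.support A M) :
    q ∈ Module.support (Localization.AtPrime p) (LocalizedModule p.primeCompl M) := by
  rw [Module.mem_support_iff'] at hq ⊢
  obtain ⟨m, hm⟩ := hq
  have hp : ∀ t ∈ p.primeCompl, t ∉ (q.comap (algebraMap A (Localization.AtPrime p))).asIdeal :=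
    fun t ht h => q.isPrime.ne_top
      (Ideal.eq_top_of_isUnit_mem _ h (IsLocalization.map_units _ ⟨t, ht⟩))
  refine ⟨LocalizedModule.mk m 1, fun r hr h0 => ?_⟩
  obtain ⟨a, s, rfl⟩ := IsLocalization.exists_mk'_eq p.primeCompl r
  have ha : a ∉ (q.comap (algebraMap A (Localization.AtPrime p))).asIdeal := fun h =>
    hr (by rw [IsLocalization.mk'_eq_mul_mk'_one]; exact Ideal.mul_mem_right _ _ h)
  rw [← Localization.mk_eq_mk', LocalizedModule.mk_smul_mk, ← LocalizedModule.zero_mk 1,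
    LocalizedModule.mk_eq] at h0
  obtain ⟨t, ht⟩ := h0
  refine hm (t * a) ?_ (by simpa [mul_smul, Submonoid.smul_def] using ht)
  exact fun h => ((PrimeSpectrum.isPrime _).mem_or_mem h).elim (hp t t.2) ha

/-- Primes below `p` correspond to primes of `A_p`, and supports are closed under specialization, so
the whole chain moves to `Supp M_p`. -/
lemma length_le_primeHeight (p : PrimeSpectrum A) (l : LTSeries (PrimeSpectrum A))
    (hhead : l.head ∈ Module.support A M) (hlast : l.last ≤ p) :
    (l.length : WithBot ℕ∞) ≤ primeHeight M p := by
  let e := IsLocalization.AtPrime.primeSpectrumOrderIso (Localization.AtPrime p.asIdeal) p.asIdeal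
  have hl (i) : l i ≤ p := (LTSeries.monotone l (Fin.le_last i)).trans hlast
  have hc (i) : (e.symm ⟨l i, hl i⟩).comap (algebraMap A (Localization.AtPrime p.asIdeal)) = l i :=
    congrArg Subtype.val (e.apply_symm_apply ⟨l i, hl i⟩)
  let l' : LTSeries (Module.support (Localization.AtPrime p.asIdeal)
      (LocalizedModule p.asIdeal.primeCompl M)) :=
    LTSeries.mk l.length (fun i => ⟨e.symm ⟨l i, hl i⟩, mem_support_localizedModule _ (by
      rw [hc]; exact Module.mem_support_mono (LTSeries.monotone l (Fin.zero_le i)) hhead)⟩)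
      fun i j hij => e.symm.strictMono (LTSeries.strictMono l hij)
  exact Order.LTSeries.length_le_krullDim l'

/-- If `dim M_p` is smaller than the length of `xs`, then a monomial in `xs` with exponents `k` is,
locally at `p` and up to the annihilator of `M`, in the ideal of the powers with exponent `k + 1`. -/
lemma exists_mul_prod_pow_mem_of_primeHeight_lt [Module.Finite A M] (p : PrimeSpectrum A)
    (xs : List A) (h : primeHeight M p < xs.length) :
    ∃ s ∉ p.asIdeal, ∃ k : ℕ, s * (xs.map (· ^ k)).prod ∈
      Module.annihilator A M ⊔ Ideal.ofList (xs.map (· ^ (k + 1))) := by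
  -- If disjoint, a prime containing `Ann M` starts a chain of length `xs.length` inside `p`, too
  -- long for `dim M_p`. Otherwise a common element gives the relation.
  by_cases hd : Disjoint (Module.annihilator A M : Set A)
      (iterBoundaryMonoid p.asIdeal.primeCompl xs)
  · obtain ⟨q, hq, hle, hqd⟩ := Ideal.exists_le_prime_disjoint _ _ hd
    obtain ⟨l, hlen, hhead, hlast⟩ := exists_ltSeries_of_disjoint_iterBoundaryMonoid xs ⟨q, hq⟩ hqd
    refine absurd (length_le_primeHeight (M := M) p l ?_ ?_) (by rw [hlen]; exact not_le.mpr h)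
    · rw [hhead, Module.support_eq_zeroLocus]; exact hle
    · exact fun a ha => not_not.mp fun h => Set.disjoint_left.mp hlast ha h
  · obtain ⟨r, hr, hrS⟩ := Set.not_disjoint_iff.mp hd
    obtain ⟨s, hs, k, hk⟩ := exists_mul_prod_pow_mem_of_mem_iterBoundaryMonoid xs hrS
    exact ⟨s, hs, k, sup_le_sup_right ((Ideal.span_singleton_le_iff_mem _).mpr hr) _ (hk k le_rfl)⟩

end Dimension

/-! ### Vanishing of the top Čech cohomology above the local dimension -/

section Cech

universe w w'

open CategoryTheory

variable {A : Type w} [CommRing A] (M : Type w') [AddCommGroup M] [Module A M]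

lemma sgn_mul_self {n : ℕ} (j : Fin n) (T : Finset (Fin n)) : sgn A j T * sgn A j T = 1 := by
  rw [sgn, ← pow_add, ← two_mul, pow_mul, neg_one_sq, one_pow]

/-- The fraction `m / a^k` in the localization `M_a`. -/
def awayFrac (a : A) (m : M) (k : ℕ) : Away M a :=
  LocalizedModule.mk m ⟨a ^ k, k, rfl⟩

lemma exists_eq_awayFrac {a : A} (z : Away M a) : ∃ m k, z = awayFrac M a m k := by
  induction z using LocalizedModule.induction_on with
  | h m s =>
    obtain ⟨_, k, rfl⟩ := s
    exact ⟨m, k, rfl⟩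

lemma pow_smul_awayFrac (a : A) (m : M) (k : ℕ) :
    a ^ k • awayFrac M a m k = LocalizedModule.mkLinearMap (Submonoid.powers a) M m := by
  rw [awayFrac, LocalizedModule.smul'_mk, LocalizedModule.mkLinearMap_apply, LocalizedModule.mk_eq]
  exact ⟨1, by simp [Submonoid.smul_def]⟩

lemma smul_awayFrac (a r : A) (m : M) (k : ℕ) :
    r • awayFrac M a m k = awayFrac M a (r • m) k :=
  LocalizedModule.smul'_mk _ _ _

lemma awayFrac_pow_smul (a : A) (m : M) (k d : ℕ) :
    awayFrac M a (a ^ d • m) (k + d) = awayFrac M a m k := by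
  rw [awayFrac, awayFrac, LocalizedModule.mk_eq]
  exact ⟨1, by simp [Submonoid.smul_def, smul_smul, pow_add]⟩

lemma awayMap_awayFrac {a c b : A} (h : a ∣ b) (e : a * c = b) (m : M) (k : ℕ) :
    awayMap M h (awayFrac M a m k) = awayFrac M b (c ^ k • m) k := by
  apply ((Module.End.isUnit_iff _).mp (isUnit_of_dvd M h ⟨a ^ k, k, rfl⟩)).1
  simp only [Module.algebraMap_end_apply]
  rw [← map_smul, pow_smul_awayFrac, awayMap_mk, smul_awayFrac, smul_smul, ← mul_pow, e,
    ← smul_awayFrac, pow_smul_awayFrac]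

/-- If `s ∏ x_i^(k l) ∈ Ann M + (x_i^(k (l + 1)))_i`, then `s m / ∏ x_i^k` is a boundary in the
top degree of the Čech complex. -/
lemma smul_mem_range_cechD_top {p : ℕ} (x : Fin (p + 1) → A) (f : CechX M x (p + 1)) {m : M}
    {k l : ℕ} (hf : f ⟨Finset.univ, by simp⟩ = awayFrac M _ m k) {s : A} {c : Fin (p + 1) → A}
    (hs : ((s * (∏ i, x i) ^ (k * l)) • m = ∑ i, (c i * x i ^ (k * (l + 1))) • m)) :
    s • f ∈ LinearMap.range (cechD M x p) := by
  -- The complement of `T` is a single index `i`. The sign cancels that of the differential, and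
  -- passing to the full product multiplies the numerator by `x_i^(k(l+1))`.
  let g : CechX M x p := fun T => ∑ i ∈ T.1ᶜ,
    sgn A i T.1 • awayFrac M _ (c i • m) (k * (l + 1))
  have hg (j : Fin (p + 1)) (hj) :
      g ⟨Finset.univ.erase j, hj⟩ = sgn A j (Finset.univ.erase j) •
        awayFrac M (∏ i ∈ Finset.univ.erase j, x i) (c j • m) (k * (l + 1)) := by
    have : (Finset.univ.erase j)ᶜ = {j} := by ext; simp
    simp only [g]
    rw [this, Finset.sum_singleton]
  refine ⟨g, funext fun T => ?_⟩
  obtain rfl : T = ⟨Finset.univ, by simp⟩ :=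
    Subtype.ext ((Finset.card_eq_iff_eq_univ _).mp (by rw [T.2, Fintype.card_fin]))
  rw [Pi.smul_apply, hf]
  have key : ∀ j, awayMap M (prod_erase_dvd x Finset.univ j)
      (awayFrac M (∏ i ∈ Finset.univ.erase j, x i) (c j • m) (k * (l + 1))) =
      awayFrac M (∏ i, x i) ((c j * x j ^ (k * (l + 1))) • m) (k * (l + 1)) := fun j => by
    rw [awayMap_awayFrac M _ (Finset.prod_erase_mul _ _ (Finset.mem_univ j)), smul_smul, mul_comm]
  have hsum (F : Fin (p + 1) → M) (d : ℕ) : ∑ j, awayFrac M (∏ i, x i) (F j) d =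
      awayFrac M (∏ i, x i) (∑ j, F j) d := by
    let φ : M →+ Away M (∏ i, x i) :=
      { toFun := fun m => awayFrac M _ m d
        map_zero' := LocalizedModule.zero_mk _
        map_add' := fun m m' => by
          rw [awayFrac, awayFrac, awayFrac, LocalizedModule.mk_add_mk, LocalizedModule.mk_eq]
          exact ⟨1, by simp [Submonoid.smul_def, smul_smul]⟩ }
    exact (map_sum φ F _).symm
  calc cechD M x p g ⟨Finset.univ, by simp⟩
      = ∑ j, awayFrac M (∏ i, x i) ((c j * x j ^ (k * (l + 1))) • m) (k * (l + 1)) := by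
        simp only [cechD, LinearMap.coe_mk, AddHom.coe_mk]
        refine Finset.sum_congr rfl fun j _ => ?_
        rw [dif_pos (Finset.mem_univ j), hg, map_smul, smul_smul, sgn_mul_self, one_smul, key]
    _ = s • awayFrac M _ m k := by
        rw [hsum, ← hs, smul_awayFrac, mul_comm s, mul_smul,
          show k * (l + 1) = k + k * l by ring, awayFrac_pow_smul]

/-- If `dim M_p` is smaller than the number of elements of the sequence `x`, then every element of
the top degree of the Čech complex becomes a boundary after multiplication by some `s ∉ p`. -/
lemma exists_smul_mem_range_cechD_top [Module.Finite A M] (q : PrimeSpectrum A) {p : ℕ}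
    (x : Fin (p + 1) → A) (h : primeHeight M q < (p + 1 : ℕ)) (f : CechX M x (p + 1)) :
    ∃ s ∉ q.asIdeal, s • f ∈ LinearMap.range (cechD M x p) := by
  obtain ⟨m, k, hf⟩ := exists_eq_awayFrac M (f ⟨Finset.univ, by simp⟩)
  -- Using the powers `x_i^k`, with `k` the exponent of the denominator, yields the exponents `k l`
  -- and `k (l + 1)`; their difference `k` restores that denominator.
  obtain ⟨s, hs, l, hl⟩ := exists_mul_prod_pow_mem_of_primeHeight_lt (M := M) q
    (List.ofFn fun i => x i ^ k) (by simpa using h)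
  refine ⟨s, hs, ?_⟩
  obtain ⟨y, hy, z, hz, e⟩ := Submodule.mem_sup.mp hl
  have hz' : z ∈ Ideal.span (Set.range fun i => x i ^ (k * (l + 1))) := by
    convert hz using 2
    ext r
    simp only [pow_mul, Set.mem_range, List.map_ofFn, List.mem_ofFn, Set.mem_ofPred_eq,
      Function.comp_apply]
  obtain ⟨c, rfl⟩ := Ideal.mem_span_range_iff_exists_fun.mp hz'
  refine smul_mem_range_cechD_top M x f hf (s := s) (c := c) (l := l) ?_
  rw [← Finset.sum_smul]
  have e' : s * (∏ i, x i) ^ (k * l) = y + ∑ i, c i * x i ^ (k * (l + 1)) := by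
    rw [e, ← Finset.prod_pow, List.map_ofFn, List.prod_ofFn]
    simp [pow_mul]
  rw [e', add_smul, Module.mem_annihilator.mp hy, zero_add]

/-- Each class is represented by a cycle, some multiple `s • z` of which is a boundary, so its image
in the localization is zero. -/
lemma subsingleton_localizedModule_homology (S : Submonoid A)
    (K : CochainComplex (ModuleCat.{w'} A) ℕ) (p : ℕ)
    (h : ∀ f : K.X (p + 1), ∃ s ∈ S, ∃ g : K.X p, K.d p (p + 1) g = s • f) :
    Subsingleton (LocalizedModule S (K.homology (p + 1))) := by
  refine LocalizedModule.subsingleton_iff.mpr fun z => ?_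
  obtain ⟨z, rfl⟩ := (ModuleCat.epi_iff_surjective (K.homologyπ (p + 1))).mp inferInstance z
  obtain ⟨s, hs, g, hg⟩ := h (K.iCycles (p + 1) z)
  refine ⟨s, hs, ?_⟩
  have hz : s • z = K.toCycles p (p + 1) g := by
    apply (ModuleCat.mono_iff_injective (K.iCycles (p + 1))).mp inferInstance
    rw [map_smul, ← ConcreteCategory.comp_apply, HomologicalComplex.toCycles_i, hg]
  rw [← map_smul, hz, ← ConcreteCategory.comp_apply, HomologicalComplex.toCycles_comp_homologyπ]
  rfl

/-- Grothendieck vanishing in the top degree: if `H^n_x(M)_q ≠ 0`, where `x` has length `n ≥ 1`,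
then `dim M_q ≥ n`. -/
lemma le_primeHeight_of_nontrivial_cechCohomology [Module.Finite A M] (q : PrimeSpectrum A) {n : ℕ}
    (hn : n ≠ 0) (x : Fin n → A)
    (h : Nontrivial (LocalizedModule q.asIdeal.primeCompl (cechCohomology M x n))) :
    (n : WithBot ℕ∞) ≤ primeHeight M q := by
  obtain ⟨p, rfl⟩ := Nat.exists_eq_succ_of_ne_zero hn
  by_contra! hlt
  refine not_subsingleton_iff_nontrivial.mpr h
    (subsingleton_localizedModule_homology _ (cechComplex M x) p fun f => ?_)
  obtain ⟨s, hs, g, hg⟩ := exists_smul_mem_range_cechD_top M q x hlt f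
  exact ⟨s, hs, g, by rw [cechComplex_d]; exact hg⟩

end Cech

/-! ### Comparison of height and grade along a strong parameter sequence -/

section Main

universe w w'

open RingTheory.Sequence

variable {A : Type w} [CommRing A] {M : Type w'} [AddCommGroup M] [Module A M] [Module.Finite A M]

lemma IsParameterSeq.length_le_idealHeight {xs : List A} (hne : xs ≠ [])
    (h : IsParameterSeq A M xs) : (xs.length : WithBot ℕ∞) ≤ idealHeight (Ideal.ofList xs) M := by
  obtain h | ⟨-, -, h⟩ := h
  · exact absurd h hne
  · refine le_iInf₂ fun p hp => ?_
    -- As `M` is finite, `Supp M ∩ V(xs) = Supp (M/xs M)`, the set of primes where the top Čech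
    -- cohomology is nonzero.
    rw [← Module.support_quotient] at hp
    exact le_primeHeight_of_nontrivial_cechCohomology M p (by simpa using hne) _ (h p hp)

/-- Induction on the length of the initial segment: height at least `i + 1` gives polynomial grade
strictly above `i`, just enough to append one element. -/
lemma IsCohenMacaulayFGIdeals.isWeaklyRegular (hM : IsCohenMacaulayFGIdeals A M) {xs : List A}
    (h : IsStrongParameterSeq A M xs) (i : ℕ) (hi : i ≤ xs.length) :
    IsWeaklyRegular M (xs.take i) := by
  induction i with
  | zero => simp
  | succ i ih =>
    have htake := List.take_succ_eq_append_getElem (Nat.lt_of_succ_le hi)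
    have hlt := (h (i + 1) (Nat.le_add_left 1 i) hi).length_le_idealHeight
      (by rw [htake]; exact List.append_ne_nil_of_right_ne_nil _ (List.cons_ne_nil _ _))
    have hfg : (Ideal.ofList (xs.take (i + 1))).FG :=
      Submodule.fg_def.mpr ⟨_, List.finite_toSet _, rfl⟩
    rw [hM _ hfg] at hlt
    rw [htake] at hlt ⊢
    rw [isWeaklyRegular_append_iff, isWeaklyRegular_singleton_iff]
    have ih := ih (Nat.le_of_succ_le hi)
    refine ⟨ih, isSMulRegular_quotient_of_lt_polynomialGrade ih ?_⟩
    have hle : (((xs.take i ++ [xs[i]]).length : ℕ) : ℕ∞) ≤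
        polynomialGrade (Ideal.ofList (xs.take i ++ [xs[i]])) M := WithBot.coe_le_coe.mp hlt
    rw [List.length_append] at hle
    exact lt_of_lt_of_le (Nat.cast_lt.mpr (Nat.lt_succ_self _)) hle

end Main

end NonNoethCM

theorem mainTheorem10 {R : Type*} [CommRing R] {M : Type*} [AddCommGroup M] [Module R M]
    [Module.Finite R M]
    (h : NonNoethCM.IsCohenMacaulayIdeals R M ∨ NonNoethCM.IsCohenMacaulayFGIdeals R M) :
    NonNoethCM.IsCohenMacaulay R M := by
  -- Only ideals generated by initial segments of the sequence matter, so the finitely generated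
  -- case suffices.
  have hM : NonNoethCM.IsCohenMacaulayFGIdeals R M := h.elim (fun h I _ => h I) id
  intro xs hxs
  by_cases hne : xs = []
  · exact Or.inl hne
  have hreg := hM.isWeaklyRegular hxs xs.length le_rfl
  have hpar := hxs xs.length (List.length_pos_iff.mpr hne) le_rfl
  rw [List.take_length] at hreg hpar
  exact Or.inr ⟨hreg, (hpar.resolve_left hne).2.1.symm⟩
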